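/- Let $\Lambda\subset\mathbb{C}$ be a period lattice (generated by two $\mathbb{R}$-linearly independent complex numbers), let $\sigma$ and $\wp$ be its Weierstrass functions, and put $$\Phi_x(y)=\Phi_x^y=\frac{\sigma(x+y)}{\sigma(x)\sigma(y)} .$$ Let $a,b,c,\xi_0\in\mathbb{C}$, $N\ge 0$, and $\kappa_1,\dots,\kappa_N,\rho^0_1,\dots,\rho^0_N\in\mathbb{C}$, where $a,b,c\notin\Lambda$, $\kappa_i+\kappa_j\notin\Lambda$ for all $i,j$ (including $i=j$), and $\kappa_i\pm a,\ \kappa_i\pm b,\ \kappa_i\pm c\notin\Lambda$ for all $i$. For $(n,m,l)\in\mathbb{Z}^3$ set $\xi=an+bm+cl+\xi_0$, $$S_i=\Phi_a(-\kappa_i)^n\,\Phi_b(-\kappa_i)^m\,\Phi_c(-\kappa_i)^l\,\rho^0_i,\qquad T_j=\Phi_a(\kappa_j)^{-n}\,\Phi_b(\kappa_j)^{-m}\,\Phi_c(\kappa_j)^{-l}\,\rho^0_j,$$ $$\mathcal{M}_{ij}=S_i\,\Phi_\xi(\kappa_i+\kappa_j)\,T_j\quad(1\le i,j\le N),\qquad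 \tau(n,m,l)=\sigma(\xi)\det(I+\mathcal{M}),$$ where $\tau(n,m,l)$ is defined whenever $\xi\notin\Lambda$. Write $\widetilde{\ },\widehat{\ },\overline{\ }$ for the shifts $n\mapsto n+1$, $m\mapsto m+1$, $l\mapsto l+1$. Then $\tau$ solves the dAKP equation with elliptic coefficients $$\Phi_a^{-b}\,\widehat{\widetilde{\tau}}\,\overline{\tau}+\Phi_b^{-c}\,\overline{\widehat{\tau}}\,\widetilde{\tau}+\Phi_c^{-a}\,\overline{\widetilde{\tau}}\,\widehat{\tau}=0$$ and the dBKP equation with elliptic coefficients $$\Phi_a^{-b}\Phi_b^{-c}\Phi_c^{-a}\,\widehat{\widetilde{\overline{\tau}}}\,\tau+\Phi_a^{-b}\wp(c)\,\widehat{\widetilde{\tau}}\,\overline{\tau}+\Phi_b^{-c}\wp(a)\,\overline{\widehat{\tau}}\,\widetilde{\tau}+\Phi_c^{-a}\wp(b)\,\overline{\widetilde{\tau}}\,\widehat{\tau}=0,$$ each of them at every $(n,m,l)\in\mathbb{Z}^3$ for which all the values of $\tau$ that occur in it are defined. -/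

import Mathlib

noncomputable section

namespace EllipticTau

/-- The Weierstrass `σ` function of the period lattice `Λ` of `L`:
`σ(z) = z ∏_{ω ∈ Λ, ω ≠ 0} (1 - z/ω) exp (z/ω + z²/(2ω²))`. -/
def sigma (L : PeriodPair) (z : ℂ) : ℂ :=
  z * ∏' ω : {ω : L.lattice // ω ≠ 0},
    (1 - z / ((ω : L.lattice) : ℂ)) *
      Complex.exp (z / ((ω : L.lattice) : ℂ) + z ^ 2 / (2 * ((ω : L.lattice) : ℂ) ^ 2))

/-- The Lamé-type function `Φ_x(y) = σ(x + y) / (σ(x) σ(y))`. -/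
def Phi (L : PeriodPair) (x y : ℂ) : ℂ :=
  sigma L (x + y) / (sigma L x * sigma L y)

/-- `ξ = a n + b m + c l + ξ₀`. -/
def xi (a b c ξ₀ : ℂ) (n m l : ℤ) : ℂ :=
  a * n + b * m + c * l + ξ₀

/-- The plane wave factor
`S_i = Φ_a(-κ_i)^n Φ_b(-κ_i)^m Φ_c(-κ_i)^l ρ⁰_i`. -/
def S (L : PeriodPair) (a b c : ℂ) {N : ℕ} (κ ρ₀ : Fin N → ℂ) (n m l : ℤ) (i : Fin N) : ℂ :=
  Phi L a (-κ i) ^ n * Phi L b (-κ i) ^ m * Phi L c (-κ i) ^ l * ρ₀ i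

/-- The plane wave factor
`T_j = Φ_a(κ_j)^{-n} Φ_b(κ_j)^{-m} Φ_c(κ_j)^{-l} ρ⁰_j`. -/
def T (L : PeriodPair) (a b c : ℂ) {N : ℕ} (κ ρ₀ : Fin N → ℂ) (n m l : ℤ) (j : Fin N) : ℂ :=
  Phi L a (κ j) ^ (-n) * Phi L b (κ j) ^ (-m) * Phi L c (κ j) ^ (-l) * ρ₀ j

/-- The elliptic Cauchy matrix `𝓜_{ij} = S_i Φ_ξ(κ_i + κ_j) T_j`. -/
def cauchyM (L : PeriodPair) (a b c ξ₀ : ℂ) {N : ℕ} (κ ρ₀ : Fin N → ℂ) (n m l : ℤ) :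
    Matrix (Fin N) (Fin N) ℂ :=
  Matrix.of fun i j =>
    S L a b c κ ρ₀ n m l i * Phi L (xi a b c ξ₀ n m l) (κ i + κ j) * T L a b c κ ρ₀ n m l j

/-- The `τ` function `τ(n, m, l) = σ(ξ) det (I + 𝓜)`. -/
def tau (L : PeriodPair) (a b c ξ₀ : ℂ) {N : ℕ} (κ ρ₀ : Fin N → ℂ) (n m l : ℤ) : ℂ :=
  sigma L (xi a b c ξ₀ n m l) * (1 + cauchyM L a b c ξ₀ κ ρ₀ n m l).det

/-- The left hand side of the discrete AKP equation with elliptic coefficients, for a lattice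
function `f`, at the lattice site `(n, m, l)`. -/
def dAKP (L : PeriodPair) (a b c : ℂ) (f : ℤ → ℤ → ℤ → ℂ) (n m l : ℤ) : ℂ :=
  Phi L a (-b) * f (n + 1) (m + 1) l * f n m (l + 1)
    + Phi L b (-c) * f n (m + 1) (l + 1) * f (n + 1) m l
    + Phi L c (-a) * f (n + 1) m (l + 1) * f n (m + 1) l

/-- The left hand side of the discrete BKP equation with elliptic coefficients, for a lattice
function `f`, at the lattice site `(n, m, l)`; `L.weierstrassP` is the Weierstrass `℘` function. -/
def dBKP (L : PeriodPair) (a b c : ℂ) (f : ℤ → ℤ → ℤ → ℂ) (n m l : ℤ) : ℂ :=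
  Phi L a (-b) * Phi L b (-c) * Phi L c (-a) * f (n + 1) (m + 1) (l + 1) * f n m l
    + Phi L a (-b) * L.weierstrassP c * f (n + 1) (m + 1) l * f n m (l + 1)
    + Phi L b (-c) * L.weierstrassP a * f n (m + 1) (l + 1) * f (n + 1) m l
    + Phi L c (-a) * L.weierstrassP b * f (n + 1) m (l + 1) * f n (m + 1) l

/-- `𝓜(n, m, l)` contains `1 / σ(ξ)`, so `τ(n, m, l)` is defined where `ξ` is not a period. -/
def DefinedAt (L : PeriodPair) (a b c ξ₀ : ℂ) (n m l : ℤ) : Prop :=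
  xi a b c ξ₀ n m l ∉ L.lattice

end EllipticTau

end

/-! ### The Weierstrass product for `sigma`: convergence, zeros, parity -/

section

open Filter Topology Complex

namespace EllipticTau

/-! Everything rests on Weierstrass' three-term identity for `sigma` (`sigma_three_term`). It
follows from `sigma_add_mul_sigma_sub`, proved by Liouville's theorem once `sigma` is known to be
quasi-periodic with (log σ)'' = -℘.

In the form `sigma_fay` the identity says that shifting one lattice variable changes the Cauchy
matrix by a rank-one matrix (`cauchyM_a`, `cauchyM_b`, `cauchyM_c`), and that the rows and columns
of these updates at neighbouring sites satisfy linear relations whose coefficients `shiftCoeff` are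
additive. All determinants in dAKP are therefore rank-one or rank-two perturbations of det(1 + 𝓜) at
one site, and the equation becomes the algebraic identity `det_bilinear`. This needs ξ off the
lattice at the base site, which dAKP does not involve; continuity in ξ₀ removes that condition.

For dBKP, replacing (c, l) by (-c, -l) conjugates the Cauchy matrix by a diagonal matrix, so τ is
unchanged (`tau_neg_c`) and satisfies a second dAKP equation, containing the product of τ at the two
opposite corners of the cube. A combination of the two equations, with Φ_x(y)Φ_x(-y) = ℘(x) - ℘(y),
is dBKP. -/

/-- The primary factor of genus two satisfies `(1 - u) exp (u + u²/2) = 1 + O(u³)`. -/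
lemma norm_primaryFactor_sub_one_le {u : ℂ} (hu : ‖u‖ ≤ 1 / 2) :
    ‖(1 - u) * exp (u + u ^ 2 / 2) - 1‖ ≤ 2 * ‖u‖ ^ 3 := by
  have h1 : (1 - u) ≠ 0 := by
    intro h
    have : u = 1 := by linear_combination -h
    rw [this] at hu
    norm_num at hu
  have h2 := norm_log_sub_logTaylor_le 2 (z := -u) (by rw [norm_neg]; linarith)
  have h3 : log (1 + -u) - logTaylor (2 + 1) (-u) = log (1 - u) + u + u ^ 2 / 2 := by
    simp [logTaylor_succ, logTaylor_zero]
    ring_nf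
  rw [h3, norm_neg] at h2
  have h4 : (1 - ‖u‖)⁻¹ ≤ 2 := by
    rw [inv_le_comm₀ (by linarith) two_pos]; linarith
  have h5 : ‖log (1 - u) + u + u ^ 2 / 2‖ ≤ ‖u‖ ^ 3 := by
    refine h2.trans ?_
    have h0 : 0 ≤ ‖u‖ ^ 3 := by positivity
    norm_num
    nlinarith
  have h6 : ‖u‖ ^ 3 ≤ 1 := pow_le_one₀ (norm_nonneg _) (by linarith)
  have h7 : (1 - u) * exp (u + u ^ 2 / 2) = exp (log (1 - u) + u + u ^ 2 / 2) := by
    rw [add_assoc, exp_add (log _), exp_log h1]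
  rw [h7]
  refine (norm_exp_sub_one_le (h5.trans h6)).trans ?_
  linarith

/-- The factor of the Weierstrass product for `σ` at the period `ω`. -/
noncomputable def sigmaFactor (L : PeriodPair) (ω : {ω : L.lattice // ω ≠ 0}) (z : ℂ) : ℂ :=
  (1 - z / ((ω : L.lattice) : ℂ)) *
    exp (z / ((ω : L.lattice) : ℂ) + z ^ 2 / (2 * ((ω : L.lattice) : ℂ) ^ 2))

/-- The entire function `σ(z) / z`. -/
noncomputable def sigmaDiv (L : PeriodPair) (z : ℂ) : ℂ := ∏' ω, sigmaFactor L ω z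

variable (L : PeriodPair)

lemma sigma_eq (z : ℂ) : sigma L z = z * sigmaDiv L z := rfl

lemma coe_ne_zero (ω : {ω : L.lattice // ω ≠ 0}) : ((ω : L.lattice) : ℂ) ≠ 0 := by
  simpa using ω.2

lemma summable_norm_inv_cube :
    Summable fun ω : {ω : L.lattice // ω ≠ 0} => ‖((ω : L.lattice) : ℂ)‖ ^ (-3 : ℝ) :=
  (ZLattice.summable_norm_rpow L.lattice (-3) (by simp; norm_num)).subtype _

lemma differentiable_sigmaFactor (ω : {ω : L.lattice // ω ≠ 0}) :
    Differentiable ℂ (sigmaFactor L ω) := by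
  unfold sigmaFactor; fun_prop

lemma sigmaFactor_eventually_le (r : ℝ) :
    ∀ᶠ ω in cofinite, ∀ z : ℂ, ‖z‖ ≤ r →
      ‖sigmaFactor L ω z - 1‖ ≤ 2 * r ^ 3 * ‖((ω : L.lattice) : ℂ)‖ ^ (-3 : ℝ) := by
  -- The cubic bound needs |z/ω| ≤ 1/2, which fails only for periods in the ball of radius 2r,
  -- finitely many by discreteness.
  have hfin : {ω : L.lattice | ‖(ω : ℂ)‖ ≤ 2 * r}.Finite := by
    refine (isCompact_iff_finite.mp (isCompact_closedBall (0 : L.lattice) (2 * r))).subset ?_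
    intro ω hω
    simpa using hω
  have hfin' : {ω : {ω : L.lattice // ω ≠ 0} | ‖((ω : L.lattice) : ℂ)‖ ≤ 2 * r}.Finite :=
    hfin.preimage Subtype.val_injective.injOn
  filter_upwards [hfin'.compl_mem_cofinite] with ω hω z hz
  simp only [Set.mem_compl_iff, Set.mem_ofPred_eq, not_le] at hω
  have h0 : 0 < ‖((ω : L.lattice) : ℂ)‖ := norm_pos_iff.mpr (coe_ne_zero L ω)
  have h1 : ‖z / ((ω : L.lattice) : ℂ)‖ ≤ 1 / 2 := by
    rw [norm_div, div_le_iff₀ h0]; linarith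
  have h2 := norm_primaryFactor_sub_one_le h1
  have h3 : (z / ((ω : L.lattice) : ℂ)) ^ 2 / 2 = z ^ 2 / (2 * ((ω : L.lattice) : ℂ) ^ 2) := by
    rw [div_pow, div_div, mul_comm]
  rw [h3] at h2
  refine h2.trans ?_
  rw [norm_div, div_pow, Real.rpow_neg h0.le, mul_assoc, ← div_eq_mul_inv]
  norm_cast
  gcongr

lemma summable_norm_sigmaFactor_sub_one (z : ℂ) :
    Summable fun ω => ‖sigmaFactor L ω z - 1‖ := by
  refine ((summable_norm_inv_cube L).mul_left (2 * ‖z‖ ^ 3)).of_norm_bounded_eventually ?_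
  filter_upwards [sigmaFactor_eventually_le L ‖z‖] with ω hω
  simpa using hω z le_rfl

lemma hasProdLocallyUniformlyOn_sigmaFactor :
    HasProdLocallyUniformlyOn (sigmaFactor L) (sigmaDiv L) Set.univ := by
  refine hasProdLocallyUniformlyOn_of_forall_compact isOpen_univ fun K _ hK => ?_
  obtain ⟨r, hr⟩ := hK.isBounded.exists_norm_le
  have := Summable.hasProdUniformlyOn_one_add (f := fun ω z => sigmaFactor L ω z - 1) hK
    ((summable_norm_inv_cube L).mul_left (2 * r ^ 3))
    ((sigmaFactor_eventually_le L r).mono fun ω hω z hz => hω z (hr z hz))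
    fun ω => ((differentiable_sigmaFactor L ω).continuous.sub continuous_const).continuousOn
  simp only [add_sub_cancel] at this
  exact this

lemma tendsto_prod_sigmaFactor :
    TendstoLocallyUniformlyOn (fun s z => ∏ ω ∈ s, sigmaFactor L ω z) (sigmaDiv L) atTop
      Set.univ :=
  hasProdLocallyUniformlyOn_iff_tendstoLocallyUniformlyOn.mp
    (hasProdLocallyUniformlyOn_sigmaFactor L)

lemma differentiable_prod_sigmaFactor (s : Finset {ω : L.lattice // ω ≠ 0}) :
    Differentiable ℂ (fun z => ∏ ω ∈ s, sigmaFactor L ω z) :=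
  Differentiable.fun_finsetProd fun ω _ => differentiable_sigmaFactor L ω

lemma differentiable_sigmaDiv : Differentiable ℂ (sigmaDiv L) := by
  rw [← differentiableOn_univ]
  exact (tendsto_prod_sigmaFactor L).differentiableOn
    (.of_forall fun s => (differentiable_prod_sigmaFactor L s).differentiableOn) isOpen_univ

lemma differentiable_sigma : Differentiable ℂ (sigma L) :=
  differentiable_id.mul (differentiable_sigmaDiv L)

lemma continuous_sigma : Continuous (sigma L) := (differentiable_sigma L).continuous

lemma sigmaFactor_ne_zero (ω : {ω : L.lattice // ω ≠ 0}) {z : ℂ}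
    (hz : z ≠ ((ω : L.lattice) : ℂ)) : sigmaFactor L ω z ≠ 0 := by
  refine mul_ne_zero ?_ (exp_ne_zero _)
  rw [sub_ne_zero, ne_comm, Ne, div_eq_one_iff_eq (coe_ne_zero L ω)]
  exact hz

lemma sigmaDiv_ne_zero {z : ℂ} (hz : ∀ ω : {ω : L.lattice // ω ≠ 0}, z ≠ ((ω : L.lattice) : ℂ)) :
    sigmaDiv L z ≠ 0 := by
  have := tprod_one_add_ne_zero_of_summable (f := fun ω => sigmaFactor L ω z - 1)
    (fun ω => by simpa using sigmaFactor_ne_zero L ω (hz ω)) (summable_norm_sigmaFactor_sub_one L z)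
  simpa [sigmaDiv] using this

lemma sigmaDiv_ne_zero_of_notMem {z : ℂ} (hz : z ∉ L.lattice) : sigmaDiv L z ≠ 0 :=
  sigmaDiv_ne_zero L fun ω h => hz (h ▸ ω.1.2)

lemma sigmaDiv_zero : sigmaDiv L 0 = 1 := by
  simp [sigmaDiv, sigmaFactor]

lemma sigma_zero : sigma L 0 = 0 := by simp [sigma]

lemma sigma_ne_zero {z : ℂ} (hz : z ∉ L.lattice) : sigma L z ≠ 0 :=
  mul_ne_zero (fun h => hz (h ▸ zero_mem _)) (sigmaDiv_ne_zero_of_notMem L hz)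

lemma sigma_eq_zero {z : ℂ} (hz : z ∈ L.lattice) : sigma L z = 0 := by
  by_cases h : z = 0
  · rw [h, sigma_zero]
  · have : sigmaDiv L z = 0 := by
      refine tprod_of_exists_eq_zero ⟨⟨⟨z, hz⟩, by simpa [Subtype.ext_iff] using h⟩, ?_⟩
      simp [sigmaFactor, h]
    rw [sigma_eq, this, mul_zero]

lemma sigmaDiv_neg (z : ℂ) : sigmaDiv L (-z) = sigmaDiv L z := by
  let e : {ω : L.lattice // ω ≠ 0} ≃ {ω : L.lattice // ω ≠ 0} :=
    (Equiv.neg L.lattice).subtypeEquiv (by simp)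
  unfold sigmaDiv
  rw [← e.tprod_eq]
  refine tprod_congr fun ω => ?_
  simp [sigmaFactor, e, Equiv.subtypeEquiv]

lemma sigma_neg (z : ℂ) : sigma L (-z) = -sigma L z := by
  rw [sigma_eq, sigma_eq, sigmaDiv_neg, neg_mul]

end EllipticTau

end

/-! ### Logarithmic derivatives and quasi-periodicity of `sigma` -/

section

open Filter Topology Complex

namespace EllipticTau

variable (L : PeriodPair)

lemma logDeriv_sigmaFactor (ω : {ω : L.lattice // ω ≠ 0}) {z : ℂ}
    (hz : z ≠ ((ω : L.lattice) : ℂ)) :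
    logDeriv (sigmaFactor L ω) z =
      1 / (z - ω.1) + 1 / ((ω : L.lattice) : ℂ) + z / ((ω : L.lattice) : ℂ) ^ 2 := by
  have h0 := coe_ne_zero L ω
  have h1 : z - ω.1 ≠ 0 := sub_ne_zero.mpr hz
  have h2 : (1 - z / ((ω : L.lattice) : ℂ)) ≠ 0 := by
    rw [sub_ne_zero, ne_comm, Ne, div_eq_one_iff_eq h0]; exact hz
  have hd : HasDerivAt (sigmaFactor L ω)
      ((-(1 / ((ω : L.lattice) : ℂ))) *
        exp (z / ((ω : L.lattice) : ℂ) + z ^ 2 / (2 * ((ω : L.lattice) : ℂ) ^ 2)) +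
      (1 - z / ((ω : L.lattice) : ℂ)) *
        (exp (z / ((ω : L.lattice) : ℂ) + z ^ 2 / (2 * ((ω : L.lattice) : ℂ) ^ 2)) *
          (1 / ((ω : L.lattice) : ℂ) + 2 * z / (2 * ((ω : L.lattice) : ℂ) ^ 2)))) z := by
    refine HasDerivAt.mul ?_ (HasDerivAt.cexp (HasDerivAt.add ?_ ?_))
    · exact ((hasDerivAt_id z).div_const _).const_sub 1
    · exact (hasDerivAt_id z).div_const _
    · simpa using (hasDerivAt_pow 2 z).div_const (2 * ((ω : L.lattice) : ℂ) ^ 2)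
  rw [logDeriv_apply, hd.deriv, sigmaFactor]
  have h3 : ((ω : L.lattice) : ℂ) - z ≠ 0 := by rw [← neg_sub]; exact neg_ne_zero.mpr h1
  have h4 := exp_ne_zero (z / ((ω : L.lattice) : ℂ) + z ^ 2 / (2 * ((ω : L.lattice) : ℂ) ^ 2))
  field_simp
  ring

lemma isOpen_compl_lattice : IsOpen ((L.lattice : Set ℂ)ᶜ) := L.isClosed_lattice.isOpen_compl

lemma deriv_logDeriv_prod_sigmaFactor (s : Finset {ω : L.lattice // ω ≠ 0}) {z : ℂ}
    (hz : z ∉ L.lattice) :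
    deriv (logDeriv fun w => ∏ ω ∈ s, sigmaFactor L ω w) z =
      ∑ ω ∈ s, -(1 / (z - ω.1) ^ 2 - 1 / ((ω : L.lattice) : ℂ) ^ 2) := by
  have hne : ∀ w ∉ L.lattice, ∀ ω : {ω : L.lattice // ω ≠ 0}, w ≠ ((ω : L.lattice) : ℂ) :=
    fun w hw ω h => hw (h ▸ ω.1.2)
  have h1 : (logDeriv fun w => ∏ ω ∈ s, sigmaFactor L ω w) =ᶠ[𝓝 z] fun w =>
      ∑ ω ∈ s, (1 / (w - ω.1) + 1 / ((ω : L.lattice) : ℂ) + w / ((ω : L.lattice) : ℂ) ^ 2) := by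
    filter_upwards [(isOpen_compl_lattice L).mem_nhds hz] with w hw
    rw [logDeriv_prod (fun ω _ => sigmaFactor_ne_zero L ω (hne w hw ω))
      (fun ω _ => (differentiable_sigmaFactor L ω) w)]
    exact Finset.sum_congr rfl fun ω _ => logDeriv_sigmaFactor L ω (hne w hw ω)
  rw [h1.deriv_eq]
  refine HasDerivAt.deriv (HasDerivAt.fun_sum fun ω _ => ?_)
  have h2 : z - ω.1 ≠ 0 := sub_ne_zero.mpr (hne z hz ω)
  have h3 := ((((hasDerivAt_id z).sub_const ((ω : L.lattice) : ℂ)).inv h2).add_const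
    (1 / ((ω : L.lattice) : ℂ))).add ((hasDerivAt_id z).div_const (((ω : L.lattice) : ℂ) ^ 2))
  convert! h3 using 1
  · ext w; simp
  · simp; ring

lemma deriv_logDeriv_eq {f : ℂ → ℂ} (hf : Differentiable ℂ f) {z : ℂ} (hz : f z ≠ 0) :
    deriv (logDeriv f) z = (deriv (deriv f) z * f z - deriv f z * deriv f z) / f z ^ 2 := by
  have hd : DifferentiableAt ℂ (deriv f) z := hf.deriv z
  exact (hd.hasDerivAt.div (hf z).hasDerivAt hz).deriv

/-- Locally uniform limits of holomorphic functions may be differentiated. For the partial products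
the left side is, up to sign, a partial sum of the ℘ series without its ω = 0 term, and both limits
are compared. -/
lemma deriv_logDeriv_sigmaDiv {z : ℂ} (hz : z ∉ L.lattice) :
    deriv (logDeriv (sigmaDiv L)) z = -(L.weierstrassP z - 1 / z ^ 2) := by
  have hsum : HasSum (fun ω : {ω : L.lattice // ω ≠ 0} =>
      -(1 / (z - ω.1) ^ 2 - 1 / ((ω : L.lattice) : ℂ) ^ 2)) (-(L.weierstrassP z - 1 / z ^ 2)) := by
    have h1 := L.hasSum_weierstrassPExcept 0 z
    have h2 : L.weierstrassPExcept 0 z = L.weierstrassP z - 1 / z ^ 2 := by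
      have := L.weierstrassPExcept_add 0 z
      simp at this
      rw [← this]; simp
    rw [h2] at h1
    refine HasSum.neg ?_
    have h3 := (hasSum_subtype_iff_of_support_subset (s := {ω : L.lattice | ω ≠ 0})
      (f := fun l : L.lattice =>
        if (l : ℂ) = 0 then 0 else (1 / (z - l) ^ 2 - 1 / (l : ℂ) ^ 2)) (by
        intro l hl h
        simp [h] at hl)).mpr h1
    convert! h3 using 1
    ext ω
    simp only [Function.comp, if_neg (coe_ne_zero L ω)]
  have h0 := tendsto_prod_sigmaFactor L
  have hd : ∀ s, DifferentiableOn ℂ (fun z => ∏ ω ∈ s, sigmaFactor L ω z) Set.univ :=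
    fun s => (differentiable_prod_sigmaFactor L s).differentiableOn
  have h1 := h0.deriv (.of_forall hd) isOpen_univ
  have h2 := h1.deriv (.of_forall fun s =>
    (differentiable_prod_sigmaFactor L s).deriv.differentiableOn) isOpen_univ
  have t0 := h0.tendsto_at (Set.mem_univ z)
  have t1 := h1.tendsto_at (Set.mem_univ z)
  have t2 := h2.tendsto_at (Set.mem_univ z)
  have hne := sigmaDiv_ne_zero_of_notMem L hz
  -- Written as (f''f - f'²)/f², the derivative of f'/f involves only quantities whose convergence
  -- is known.
  have t3 := ((t2.mul t0).sub (t1.mul t1)).div (t0.pow 2) (pow_ne_zero 2 hne)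
  rw [deriv_logDeriv_eq (differentiable_sigmaDiv L) hne]
  refine tendsto_nhds_unique t3 (Tendsto.congr (fun s => ?_) hsum)
  rw [← deriv_logDeriv_prod_sigmaFactor L s hz,
    deriv_logDeriv_eq (differentiable_prod_sigmaFactor L s)]
  · rfl
  · exact Finset.prod_ne_zero_iff.mpr fun ω _ => sigmaFactor_ne_zero L ω fun h => hz (h ▸ ω.1.2)

/-- The logarithmic derivative of `σ` has the derivative `-℘`. -/
lemma deriv_logDeriv_sigma {z : ℂ} (hz : z ∉ L.lattice) :
    deriv (logDeriv (sigma L)) z = -L.weierstrassP z := by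
  have h1 : logDeriv (sigma L) =ᶠ[𝓝 z] fun w => w⁻¹ + logDeriv (sigmaDiv L) w := by
    filter_upwards [(isOpen_compl_lattice L).mem_nhds hz] with w hw
    have hw0 : w ≠ 0 := fun h => hw (h ▸ zero_mem _)
    have := logDeriv_mul (f := fun x => x) (g := sigmaDiv L) w hw0
      (sigmaDiv_ne_zero_of_notMem L hw) differentiableAt_id (differentiable_sigmaDiv L w)
    rw [logDeriv_id', one_div] at this
    exact this
  have hz0 : z ≠ 0 := fun h => hz (h ▸ zero_mem _)
  have hd : DifferentiableAt ℂ (logDeriv (sigmaDiv L)) z :=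
    ((differentiable_sigmaDiv L).deriv z).div (differentiable_sigmaDiv L z)
      (sigmaDiv_ne_zero_of_notMem L hz)
  rw [h1.deriv_eq, deriv_fun_add (differentiableAt_inv hz0) hd, deriv_logDeriv_sigmaDiv L hz]
  simp
  ring

lemma isPreconnected_compl_lattice : IsPreconnected ((L.lattice : Set ℂ)ᶜ) := by
  refine (Set.Countable.isConnected_compl_of_one_lt_rank (by simp) ?_).2
  exact (Set.countable_coe_iff.mp (inferInstanceAs (Countable L.lattice)))

lemma dense_compl_lattice : Dense ((L.lattice : Set ℂ)ᶜ) :=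
  Set.Countable.dense_compl ℂ (Set.countable_coe_iff.mp (inferInstanceAs (Countable L.lattice)))

/-- Integrate the periodicity of ℘ twice over the connected complement of the lattice: the first
constant of integration is η, the second is C. -/
lemma sigma_quasiPeriodic {ω : ℂ} (hω : ω ∈ L.lattice) :
    ∃ C η : ℂ, C ≠ 0 ∧ ∀ z, sigma L (z + ω) = C * exp (η * z) * sigma L z := by
  have hmem : ∀ {z}, z ∉ L.lattice → z + ω ∉ L.lattice := fun {z} hz h =>
    hz (by simpa using sub_mem h hω)
  have hU := isOpen_compl_lattice L
  have hdz : ∀ z ∉ L.lattice, DifferentiableAt ℂ (logDeriv (sigma L)) z := fun z hz =>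
    ((differentiable_sigma L).deriv z).div (differentiable_sigma L z) (sigma_ne_zero L hz)
  have hdshift : ∀ z ∉ L.lattice, DifferentiableAt ℂ (fun z => logDeriv (sigma L) (z + ω)) z :=
    fun z hz => (hdz _ (hmem hz)).comp z (by fun_prop)
  have hshift : Differentiable ℂ fun z => sigma L (z + ω) :=
    (differentiable_sigma L).comp (differentiable_id.add_const ω)
  have hlog : ∀ z, logDeriv (fun z => sigma L (z + ω)) z = logDeriv (sigma L) (z + ω) := by
    intro z
    simp only [logDeriv_apply, deriv_comp_add_const]
  obtain ⟨η, hη⟩ : ∃ η, ∀ z ∉ L.lattice,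
      logDeriv (sigma L) (z + ω) - logDeriv (sigma L) z = η := by
    refine hU.exists_is_const_of_deriv_eq_zero (isPreconnected_compl_lattice L)
      (f := fun z => logDeriv (sigma L) (z + ω) - logDeriv (sigma L) z) ?_ ?_
    · intro z hz
      exact ((hdshift z hz).sub (hdz z hz)).differentiableWithinAt
    · intro z hz
      rw [deriv_fun_sub (hdshift z hz) (hdz z hz), deriv_comp_add_const, deriv_logDeriv_sigma L (hmem hz),
        deriv_logDeriv_sigma L hz]
      have := L.weierstrassP_add_coe z ⟨ω, hω⟩
      simp only at this
      simp [this]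
  have hexp : Differentiable ℂ fun z : ℂ => exp (η * z) := by fun_prop
  have key : Set.EqOn (logDeriv fun z => sigma L (z + ω))
      (logDeriv ((fun z => exp (η * z)) * sigma L)) (L.lattice : Set ℂ)ᶜ := by
    intro z hz
    rw [hlog]
    change _ = logDeriv (fun z => exp (η * z) * sigma L z) z
    rw [logDeriv_mul (f := fun z => exp (η * z)) z (exp_ne_zero _) (sigma_ne_zero L hz) (hexp z)
      (differentiable_sigma L z)]
    have : logDeriv (fun z => exp (η * z)) z = η := by
      have : HasDerivAt (fun z => exp (η * z)) (exp (η * z) * (η * 1)) z :=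
        ((hasDerivAt_id z).const_mul η).cexp
      rw [logDeriv_apply, this.deriv]
      field_simp
    rw [this, ← hη z hz]; ring
  rw [logDeriv_eqOn_iff hshift.differentiableOn
    (hexp.mul (differentiable_sigma L)).differentiableOn hU (isPreconnected_compl_lattice L)
    (fun z hz => mul_ne_zero (exp_ne_zero _) (sigma_ne_zero L hz))
    (fun z hz => sigma_ne_zero L (hmem hz))] at key
  obtain ⟨C, hC, h⟩ := key
  refine ⟨C, η, hC, fun z => ?_⟩
  by_cases hz : z ∈ L.lattice
  · rw [sigma_eq_zero L (add_mem hz hω), sigma_eq_zero L hz, mul_zero]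
  · simpa [mul_assoc] using h hz

end EllipticTau

end

/-! ### The addition formula and the three-term identity for `sigma` -/

section

open Filter Topology Complex

namespace EllipticTau

variable (L : PeriodPair)

/-- Evenness kills the derivative at 0, so the zero there is at least double; two divided slopes
extract it. This cancels the double pole of `sigmaRelation` at the periods. -/
lemma exists_eq_sq_mul_of_even {N : ℂ → ℂ} (hN : Differentiable ℂ N) (heven : ∀ z, N (-z) = N z)
    (h0 : N 0 = 0) : ∃ M : ℂ → ℂ, Differentiable ℂ M ∧ ∀ z, N z = z ^ 2 * M z := by
  have hd : ∀ {f : ℂ → ℂ}, Differentiable ℂ f → Differentiable ℂ (dslope f 0) := fun {f} hf =>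
    differentiableOn_univ.mp
      ((differentiableOn_dslope univ_mem).mpr (differentiableOn_univ.mpr hf))
  have hder : deriv N 0 = 0 := by
    have h := deriv_comp_neg N 0
    simp only [heven, neg_zero] at h
    exact self_eq_neg.mp h
  refine ⟨dslope (dslope N 0) 0, hd (hd hN), fun z => ?_⟩
  have h1 := sub_smul_dslope N 0 z
  have h2 := sub_smul_dslope (dslope N 0) 0 z
  rw [dslope_same, hder] at h2
  simp only [sub_zero, smul_eq_mul, h0] at h1 h2
  rw [← h1, ← h2]; ring

/-- The elliptic function `σ(z + y) σ(z - y) / σ(z)² + σ(y)² (℘(z) - ℘(y))`, with the value `c` at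
the periods. -/
noncomputable def sigmaRelation (y c z : ℂ) : ℂ :=
  open Classical in
  if z ∈ L.lattice then c else
    sigma L (z + y) * sigma L (z - y) / sigma L z ^ 2 +
      sigma L y ^ 2 * (L.weierstrassP z - L.weierstrassP y)

lemma sigmaRelation_periodic (y c : ℂ) {ω : ℂ} (hω : ω ∈ L.lattice) (z : ℂ) :
    sigmaRelation L y c (z + ω) = sigmaRelation L y c z := by
  obtain ⟨C, η, hC, h⟩ := sigma_quasiPeriodic L hω
  have hmem : z + ω ∈ L.lattice ↔ z ∈ L.lattice := by
    simpa using (L.lattice.toAddSubgroup.add_mem_cancel_right (y := z) hω)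
  unfold sigmaRelation
  by_cases hz : z ∈ L.lattice
  · rw [if_pos hz, if_pos (hmem.mpr hz)]
  · rw [if_neg hz, if_neg (fun h => hz (hmem.mp h))]
    have h1 : z + ω + y = (z + y) + ω := by ring
    have h2 : z + ω - y = (z - y) + ω := by ring
    have h3 := L.weierstrassP_add_coe z ⟨ω, hω⟩
    simp only at h3
    rw [h1, h2, h, h, h, h3]
    congr 1
    -- The exponents of the two shifted factors add up to 2ηz, matching the denominator.
    have h4 : exp (η * (z + y)) * exp (η * (z - y)) = exp (η * z) ^ 2 := by
      rw [← exp_add, ← exp_nat_mul]; congr 1; push_cast; ring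
    have h5 := sigma_ne_zero L hz
    have h6 := exp_ne_zero (η * z)
    rw [div_eq_div_iff (by positivity) (by positivity)]
    linear_combination C ^ 2 * sigma L (z + y) * sigma L (z - y) * sigma L z ^ 2 * h4

/-- Near 0 the double poles of the quotient and of ℘ cancel, since the numerator combined over z² is
even and vanishes at 0. The value `c` is that of the regularised function `Q` at 0, and periodicity
carries it to every period. -/
lemma exists_differentiable_sigmaRelation (y : ℂ) :
    ∃ c, Differentiable ℂ (sigmaRelation L y c) := by
  have hs := differentiable_sigma L
  have hu := differentiable_sigmaDiv L
  obtain ⟨M, hM, hNM⟩ := exists_eq_sq_mul_of_even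
    (N := fun z => sigma L (z + y) * sigma L (z - y) + sigma L y ^ 2 * sigmaDiv L z ^ 2)
    (by fun_prop) (fun z => by
      have h1 : -z + y = -(z - y) := by ring
      have h2 : -z - y = -(z + y) := by ring
      rw [h1, h2, sigma_neg, sigma_neg, sigmaDiv_neg]; ring)
    (by simp [sigma_neg, sigmaDiv_zero]; ring)
  let Q : ℂ → ℂ := fun z => M z / sigmaDiv L z ^ 2 +
    sigma L y ^ 2 * (L.weierstrassPExcept 0 z - L.weierstrassP y)
  have hQ : DifferentiableAt ℂ Q 0 := by
    have h1 : DifferentiableAt ℂ (L.weierstrassPExcept 0) 0 :=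
      (L.differentiableOn_weierstrassPExcept 0).differentiableAt
        (L.compl_lattice_sdiff_singleton_mem_nhds 0)
    have h2 : sigmaDiv L 0 ^ 2 ≠ 0 := by simp [sigmaDiv_zero]
    have h3 := hM 0
    have h4 : DifferentiableAt ℂ (fun z => sigmaDiv L z ^ 2) 0 := (hu 0).pow 2
    exact (h3.div h4 h2).add ((h1.sub_const _).const_mul _)
  have h0 : sigmaRelation L y (Q 0) =ᶠ[𝓝 0] Q := by
    filter_upwards [L.compl_lattice_sdiff_singleton_mem_nhds 0] with z hz
    unfold sigmaRelation
    by_cases hz0 : z = 0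
    · rw [if_pos (hz0 ▸ zero_mem _), hz0]
    · have hzL : z ∉ L.lattice := fun h => hz ⟨h, hz0⟩
      have h2 : L.weierstrassPExcept 0 z = L.weierstrassP z - 1 / z ^ 2 := by
        have := L.weierstrassPExcept_add 0 z
        simp at this
        rw [← this]; simp
      rw [if_neg hzL]
      have h3 := sigmaDiv_ne_zero_of_notMem L hzL
      have h4 := hNM z
      simp only [Q, h2]
      rw [sigma_eq L z]
      field_simp
      linear_combination h4
  refine ⟨Q 0, fun z => ?_⟩
  by_cases hz : z ∈ L.lattice
  · have h1 : DifferentiableAt ℂ (sigmaRelation L y (Q 0)) (z - z) := by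
      rw [sub_self]; exact hQ.congr_of_eventuallyEq h0
    have h2 : sigmaRelation L y (Q 0) = fun w => sigmaRelation L y (Q 0) (w - z) := by
      ext w
      rw [sub_eq_add_neg, sigmaRelation_periodic L y _ (neg_mem hz)]
    rw [h2]
    exact h1.comp (f := fun w => w - z) z (by fun_prop)
  · have h1 : sigmaRelation L y (Q 0) =ᶠ[𝓝 z] fun z =>
        sigma L (z + y) * sigma L (z - y) / sigma L z ^ 2 +
          sigma L y ^ 2 * (L.weierstrassP z - L.weierstrassP y) := by
      filter_upwards [(isOpen_compl_lattice L).mem_nhds hz] with w hw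
      exact if_neg hw
    refine DifferentiableAt.congr_of_eventuallyEq ?_ h1
    have h2 : DifferentiableAt ℂ L.weierstrassP z :=
      L.differentiableOn_weierstrassP.differentiableAt ((isOpen_compl_lattice L).mem_nhds hz)
    have h3 : DifferentiableAt ℂ (fun z => sigma L (z + y) * sigma L (z - y)) z := by fun_prop
    have h4 : DifferentiableAt ℂ (fun z => sigma L z ^ 2) z := by fun_prop
    exact (h3.div h4 (pow_ne_zero 2 (sigma_ne_zero L hz))).add ((h2.sub_const _).const_mul _)

/-- `σ(x + y) σ(x - y) / (σ(x)² σ(y)²) = -(℘(x) - ℘(y))`. -/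
lemma sigma_add_mul_sigma_sub {x y : ℂ} (hx : x ∉ L.lattice) (hy : y ∉ L.lattice) :
    sigma L (x + y) * sigma L (x - y) =
      -(L.weierstrassP x - L.weierstrassP y) * sigma L x ^ 2 * sigma L y ^ 2 := by
  obtain ⟨c, hc⟩ := exists_differentiable_sigmaRelation L y
  -- Liouville: a continuous periodic function has compact range. The constant is read off at y,
  -- where both summands vanish.
  have h1 : sigmaRelation L y c x = sigmaRelation L y c y :=
    hc.apply_eq_apply_of_bounded (IsZLattice.isCompact_range_of_periodic L.lattice _
      hc.continuous fun z w hw => sigmaRelation_periodic L y c hw z).isBounded x y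
  rw [sigmaRelation, if_neg hx, sigmaRelation, if_neg hy, sub_self, sub_self, sigma_zero] at h1
  have h2 := sigma_ne_zero L hx
  field_simp at h1
  linear_combination h1

/-- After the addition formula a common factor splits off, leaving (X-Y)(Z-W) + (Y-Z)(X-W) +
(Z-X)(Y-W) = 0 for the ℘-values. -/
lemma sigma_three_term_of_notMem {x y z w : ℂ} (hx : x ∉ L.lattice) (hy : y ∉ L.lattice)
    (hz : z ∉ L.lattice) (hw : w ∉ L.lattice) :
    sigma L (x + y) * sigma L (x - y) * (sigma L (z + w) * sigma L (z - w)) +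
      sigma L (y + z) * sigma L (y - z) * (sigma L (x + w) * sigma L (x - w)) +
      sigma L (z + x) * sigma L (z - x) * (sigma L (y + w) * sigma L (y - w)) = 0 := by
  rw [sigma_add_mul_sigma_sub L hx hy, sigma_add_mul_sigma_sub L hz hw,
    sigma_add_mul_sigma_sub L hy hz, sigma_add_mul_sigma_sub L hx hw,
    sigma_add_mul_sigma_sub L hz hx, sigma_add_mul_sigma_sub L hy hw]
  ring

lemma eq_zero_of_continuous_of_notMem {f : ℂ → ℂ} (hf : Continuous f)
    (h : ∀ z ∉ L.lattice, f z = 0) (z : ℂ) : f z = 0 :=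
  congrFun (hf.ext_on (dense_compl_lattice L) continuous_const fun z hz => h z hz) z

/-- Weierstrass' three-term identity for `σ`. -/
lemma sigma_three_term (x y z w : ℂ) :
    sigma L (x + y) * sigma L (x - y) * (sigma L (z + w) * sigma L (z - w)) +
      sigma L (y + z) * sigma L (y - z) * (sigma L (x + w) * sigma L (x - w)) +
      sigma L (z + x) * sigma L (z - x) * (sigma L (y + w) * sigma L (y - w)) = 0 := by
  have hs := continuous_sigma L
  -- Both sides are entire in each variable, so the lattice is removed one variable at a time by
  -- density.
  refine eq_zero_of_continuous_of_notMem L (f := fun x =>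
    sigma L (x + y) * sigma L (x - y) * (sigma L (z + w) * sigma L (z - w)) +
      sigma L (y + z) * sigma L (y - z) * (sigma L (x + w) * sigma L (x - w)) +
      sigma L (z + x) * sigma L (z - x) * (sigma L (y + w) * sigma L (y - w)))
    (by fun_prop) (fun x hx => ?_) x
  refine eq_zero_of_continuous_of_notMem L (f := fun y =>
    sigma L (x + y) * sigma L (x - y) * (sigma L (z + w) * sigma L (z - w)) +
      sigma L (y + z) * sigma L (y - z) * (sigma L (x + w) * sigma L (x - w)) +
      sigma L (z + x) * sigma L (z - x) * (sigma L (y + w) * sigma L (y - w)))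
    (by fun_prop) (fun y hy => ?_) y
  refine eq_zero_of_continuous_of_notMem L (f := fun z =>
    sigma L (x + y) * sigma L (x - y) * (sigma L (z + w) * sigma L (z - w)) +
      sigma L (y + z) * sigma L (y - z) * (sigma L (x + w) * sigma L (x - w)) +
      sigma L (z + x) * sigma L (z - x) * (sigma L (y + w) * sigma L (y - w)))
    (by fun_prop) (fun z hz => ?_) z
  exact eq_zero_of_continuous_of_notMem L (f := fun w =>
    sigma L (x + y) * sigma L (x - y) * (sigma L (z + w) * sigma L (z - w)) +
      sigma L (y + z) * sigma L (y - z) * (sigma L (x + w) * sigma L (x - w)) +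
      sigma L (z + x) * sigma L (z - x) * (sigma L (y + w) * sigma L (y - w)))
    (by fun_prop) (fun w hw => sigma_three_term_of_notMem L hx hy hz hw) w

end EllipticTau

end

/-! ### Determinants of low-rank perturbations -/

section

open Filter Topology Complex

namespace EllipticTau

section Determinants

open Matrix

variable {ι : Type*} [Fintype ι] [DecidableEq ι] {F : Type*} [Field F]

/-- Factor out `A`; then det(1 - XY) = det(1 - YX) reduces the rank-two correction to a 2 × 2
determinant. -/
lemma det_sub_vecMulVec_sub_vecMulVec (A : Matrix ι ι F) (hA : IsUnit A.det) (u v u' v' : ι → F) :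
    (A - vecMulVec u v - vecMulVec u' v').det =
      A.det * ((1 - v ⬝ᵥ (A⁻¹ *ᵥ u)) * (1 - v' ⬝ᵥ (A⁻¹ *ᵥ u')) -
        (v ⬝ᵥ (A⁻¹ *ᵥ u')) * (v' ⬝ᵥ (A⁻¹ *ᵥ u))) := by
  let U : Matrix ι (Fin 2) F := (of ![u, u'])ᵀ
  let V : Matrix (Fin 2) ι F := of ![v, v']
  have h1 : A - vecMulVec u v - vecMulVec u' v' = A * (1 - A⁻¹ * U * V) := by
    rw [mul_sub, mul_one, Matrix.mul_assoc, mul_nonsing_inv_cancel_left _ _ hA, sub_sub]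
    congr 1
    ext i j
    simp [U, V, mul_apply, vecMulVec_apply]
  have h2 : ∀ k l, (V * (A⁻¹ * U)) k l = (![v, v'] k) ⬝ᵥ (A⁻¹ *ᵥ (![u, u'] l)) := fun k l => rfl
  rw [h1, det_mul, det_one_sub_mul_comm, det_fin_two]
  simp [Matrix.sub_apply, h2, one_apply]

lemma det_sub_vecMulVec (A : Matrix ι ι F) (hA : IsUnit A.det) (u v : ι → F) :
    (A - vecMulVec u v).det = A.det * (1 - v ⬝ᵥ (A⁻¹ *ᵥ u)) := by
  have := det_sub_vecMulVec_sub_vecMulVec A hA u v 0 0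
  simpa using this

/-- In the application `A` is 1 + 𝓜 at the base site, r, p, q are columns at the base, a- and
b-shifted sites, and the s-vectors are rows at the sites named by their letters. -/
lemma det_bilinear_of_isUnit (A : Matrix ι ι F) (hA : IsUnit A.det)
    {r p q sa sb sc sab sbc sac : ι → F} {k₁ k₂ k₃ : F}
    (hq : q = p + k₁ • r) (hab : sa - sb = k₁ • sab) (hbc : sb - sc = k₂ • sbc)
    (hac : sa - sc = k₃ • sac) (hk : k₁ + k₂ = k₃) :
    k₁ * (A - vecMulVec r sa - vecMulVec p sab).det * (A - vecMulVec r sc).det +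
      k₂ * (A - vecMulVec r sb - vecMulVec q sbc).det * (A - vecMulVec r sa).det -
      k₃ * (A - vecMulVec r sa - vecMulVec p sac).det * (A - vecMulVec r sb).det = 0 := by
  have dot : ∀ {x y w : ι → F} {k : F}, x - y = k • w → ∀ z : ι → F,
      k * (w ⬝ᵥ z) = x ⬝ᵥ z - y ⬝ᵥ z := by
    intro x y w k h z
    rw [← sub_dotProduct, h, smul_dotProduct, smul_eq_mul]
  simp only [det_sub_vecMulVec_sub_vecMulVec A hA, det_sub_vecMulVec A hA, hq, mulVec_add,
    mulVec_smul, dotProduct_add, dotProduct_smul, smul_eq_mul]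
  set R := A⁻¹ *ᵥ r
  set P := A⁻¹ *ᵥ p
  have e1 := dot hab R
  have e2 := dot hab P
  have e3 := dot hbc R
  have e4 := dot hbc P
  have e5 := dot hac R
  have e6 := dot hac P
  generalize sa ⬝ᵥ R = a1 at *
  generalize sb ⬝ᵥ R = b1 at *
  generalize sc ⬝ᵥ R = c1 at *
  generalize sa ⬝ᵥ P = a2 at *
  generalize sb ⬝ᵥ P = b2 at *
  generalize sc ⬝ᵥ P = c2 at *
  generalize sab ⬝ᵥ R = ab1 at *
  generalize sab ⬝ᵥ P = ab2 at *
  generalize sbc ⬝ᵥ R = bc1 at *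
  generalize sbc ⬝ᵥ P = bc2 at *
  generalize sac ⬝ᵥ R = ac1 at *
  generalize sac ⬝ᵥ P = ac2 at *
  -- Each k multiplies exactly one doubly shifted determinant, so the row relations are used without
  -- dividing by k, which may vanish. What remains is polynomial in six scalars.
  have f1 : k₁ * ((1 - a1) * (1 - ab2) - a2 * ab1) =
      (1 - a1) * (k₁ - (a2 - b2)) - a2 * (a1 - b1) := by
    linear_combination -(1 - a1) * e2 - a2 * e1
  have f2 : k₂ * ((1 - b1) * (1 - (bc2 + k₁ * bc1)) - (b2 + k₁ * b1) * bc1) =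
      (1 - b1) * (k₂ - (b2 - c2) - k₁ * (b1 - c1)) - (b2 + k₁ * b1) * (b1 - c1) := by
    linear_combination -(1 - b1) * e4 - ((1 - b1) * k₁ + (b2 + k₁ * b1)) * e3
  have f3 : k₃ * ((1 - a1) * (1 - ac2) - a2 * ac1) =
      (1 - a1) * (k₃ - (a2 - c2)) - a2 * (a1 - c1) := by
    linear_combination -(1 - a1) * e6 - a2 * e5
  linear_combination A.det ^ 2 * ((1 - c1) * f1 + (1 - a1) * f2 - (1 - b1) * f3 +
    (1 - a1) * (1 - b1) * hk)

/-- Invertibility is dropped by perturbing to A + t: both sides are continuous in t, and A + t is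
singular only at the finitely many roots of the characteristic polynomial of -A. -/
lemma det_bilinear (A : Matrix ι ι ℂ) {r p q sa sb sc sab sbc sac : ι → ℂ} {k₁ k₂ k₃ : ℂ}
    (hq : q = p + k₁ • r) (hab : sa - sb = k₁ • sab) (hbc : sb - sc = k₂ • sbc)
    (hac : sa - sc = k₃ • sac) (hk : k₁ + k₂ = k₃) :
    k₁ * (A - vecMulVec r sa - vecMulVec p sab).det * (A - vecMulVec r sc).det +
      k₂ * (A - vecMulVec r sb - vecMulVec q sbc).det * (A - vecMulVec r sa).det -
      k₃ * (A - vecMulVec r sa - vecMulVec p sac).det * (A - vecMulVec r sb).det = 0 := by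
  let B : ℂ → Matrix ι ι ℂ := fun t => A + scalar ι t
  have hB : Continuous B := by
    refine continuous_const.add ?_
    change Continuous fun t : ℂ => diagonal fun _ : ι => t
    exact Continuous.matrix_diagonal (by fun_prop)
  let f : ℂ → ℂ := fun t =>
    k₁ * (B t - vecMulVec r sa - vecMulVec p sab).det * (B t - vecMulVec r sc).det +
      k₂ * (B t - vecMulVec r sb - vecMulVec q sbc).det * (B t - vecMulVec r sa).det -
      k₃ * (B t - vecMulVec r sa - vecMulVec p sac).det * (B t - vecMulVec r sb).det
  have hf : Continuous f := by
    have hd : ∀ C : Matrix ι ι ℂ, Continuous fun t => (B t - C).det := fun C =>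
      (hB.sub continuous_const).matrix_det
    have hd' : ∀ C D : Matrix ι ι ℂ, Continuous fun t => (B t - C - D).det := fun C D =>
      ((hB.sub continuous_const).sub continuous_const).matrix_det
    have := hd (vecMulVec r sa)
    have := hd (vecMulVec r sb)
    have := hd (vecMulVec r sc)
    have := hd' (vecMulVec r sa) (vecMulVec p sab)
    have := hd' (vecMulVec r sb) (vecMulVec q sbc)
    have := hd' (vecMulVec r sa) (vecMulVec p sac)
    fun_prop
  have hdense : Dense {t : ℂ | (B t).det = 0}ᶜ := by
    refine Set.Countable.dense_compl ℂ (Set.Finite.countable ?_)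
    refine ((-A).charpoly.rootSet_finite ℂ).subset fun t ht => ?_
    rw [Polynomial.mem_rootSet]
    refine ⟨(charpoly_monic _).ne_zero, ?_⟩
    rw [Polynomial.coe_aeval_eq_eval, eval_charpoly, sub_neg_eq_add, add_comm]
    exact ht
  have h0 : f = fun _ => 0 := hf.ext_on hdense continuous_const fun t ht =>
    det_bilinear_of_isUnit (B t) (isUnit_iff_ne_zero.mpr ht) hq hab hbc hac hk
  have h1 := congrFun h0 0
  simpa [f, B] using h1

end Determinants

end EllipticTau

end

/-! ### Identities for Φ -/

section

open Filter Topology Complex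

namespace EllipticTau

variable (L : PeriodPair)

/-- The three-term identity for `σ` in the form adapted to the functions `Φ`. -/
lemma sigma_fay (x a p q : ℂ) :
    sigma L (x + a + p + q) * sigma L x * sigma L q * sigma L (a - p) +
      sigma L (x + p + q) * sigma L (x + a) * sigma L (a + q) * sigma L p -
      sigma L (x + a + q) * sigma L (x + p) * sigma L (p + q) * sigma L a = 0 := by
  -- The half-sums are chosen so that the twelve sums and differences become the arguments in the
  -- statement, up to one sign.
  have h := sigma_three_term L (x + (a + p + q) / 2) ((a + p + q) / 2) ((a + q - p) / 2)
    ((q - a + p) / 2)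
  have e1 : x + (a + p + q) / 2 + (a + p + q) / 2 = x + a + p + q := by ring
  have e2 : x + (a + p + q) / 2 - (a + p + q) / 2 = x := by ring
  have e3 : (a + q - p) / 2 + (q - a + p) / 2 = q := by ring
  have e4 : (a + q - p) / 2 - (q - a + p) / 2 = a - p := by ring
  have e5 : (a + p + q) / 2 + (a + q - p) / 2 = a + q := by ring
  have e6 : (a + p + q) / 2 - (a + q - p) / 2 = p := by ring
  have e7 : x + (a + p + q) / 2 + (q - a + p) / 2 = x + p + q := by ring
  have e8 : x + (a + p + q) / 2 - (q - a + p) / 2 = x + a := by ring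
  have e9 : (a + q - p) / 2 + (x + (a + p + q) / 2) = x + a + q := by ring
  have e10 : (a + q - p) / 2 - (x + (a + p + q) / 2) = -(x + p) := by ring
  have e11 : (a + p + q) / 2 + (q - a + p) / 2 = p + q := by ring
  have e12 : (a + p + q) / 2 - (q - a + p) / 2 = a := by ring
  rw [e1, e2, e3, e4, e5, e6, e7, e8, e9, e10, e11, e12, sigma_neg] at h
  linear_combination h

variable {L}

lemma Phi_ne_zero {x y : ℂ} (hx : x ∉ L.lattice) (hy : y ∉ L.lattice) (hxy : x + y ∉ L.lattice) :
    Phi L x y ≠ 0 :=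
  div_ne_zero (sigma_ne_zero L hxy) (mul_ne_zero (sigma_ne_zero L hx) (sigma_ne_zero L hy))

lemma Phi_comm (x y : ℂ) : Phi L x y = Phi L y x := by
  unfold Phi; rw [add_comm, mul_comm (sigma L x)]

lemma Phi_neg_neg (x y : ℂ) : Phi L (-x) (-y) = -Phi L x y := by
  unfold Phi
  rw [← neg_add, sigma_neg, sigma_neg, sigma_neg, neg_mul_neg, neg_div]

lemma Phi_neg_left (x y : ℂ) : Phi L (-x) y = -Phi L x (-y) := by
  rw [← Phi_neg_neg, neg_neg]

/-- `Φ_x(y) Φ_x(-y) = ℘(x) - ℘(y)`. -/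
lemma Phi_mul_Phi_neg {x y : ℂ} (hx : x ∉ L.lattice) (hy : y ∉ L.lattice) :
    Phi L x y * Phi L x (-y) = L.weierstrassP x - L.weierstrassP y := by
  have h := sigma_add_mul_sigma_sub L hx hy
  have h1 := sigma_ne_zero L hx
  have h2 := sigma_ne_zero L hy
  unfold Phi
  rw [← sub_eq_add_neg, sigma_neg]
  field_simp
  linear_combination -h

/-- This makes a shift of the Cauchy matrix rank one: the last product separates the dependence on p
and q. -/
lemma Phi_mul_Phi_shift {x d p q : ℂ} (hx : x ∉ L.lattice) (hxd : x + d ∉ L.lattice)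
    (hd : d ∉ L.lattice) (hp : p ∉ L.lattice) (hq : q ∉ L.lattice) (hpq : p + q ∉ L.lattice) :
    Phi L d (-p) * Phi L (x + d) (p + q) =
      Phi L x (p + q) * Phi L d q - Phi L x p * Phi L (x + d) q := by
  have h := sigma_fay L x d p q
  have h1 := sigma_ne_zero L hx
  have h2 := sigma_ne_zero L hxd
  have h3 := sigma_ne_zero L hd
  have h4 := sigma_ne_zero L hp
  have h5 := sigma_ne_zero L hq
  have h6 := sigma_ne_zero L hpq
  unfold Phi
  rw [← sub_eq_add_neg, sigma_neg, ← add_assoc, ← add_assoc]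
  field_simp
  linear_combination -h

/-- The coefficient in the linear relations between the vectors shifted in two directions. -/
noncomputable def shiftCoeff (L : PeriodPair) (x a b : ℂ) : ℂ :=
  sigma L x * sigma L (a - b) * sigma L (x + a + b) /
    (sigma L (x + a) * sigma L (x + b) * sigma L a * sigma L b)

lemma Phi_shift_sub_left {x a b k : ℂ} (hxa : x + a ∉ L.lattice) (hxb : x + b ∉ L.lattice)
    (hxab : x + a + b ∉ L.lattice) (ha : a ∉ L.lattice) (hb : b ∉ L.lattice)
    (hk : k ∉ L.lattice) :
    Phi L (x + a) k * Phi L b k - Phi L (x + b) k * Phi L a k =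
      shiftCoeff L x a b * Phi L (x + a + b) k := by
  have h := sigma_fay L x a b k
  have h2 := sigma_ne_zero L hxa
  have h3 := sigma_ne_zero L hxb
  have h4 := sigma_ne_zero L hxab
  have h5 := sigma_ne_zero L ha
  have h6 := sigma_ne_zero L hb
  have h7 := sigma_ne_zero L hk
  unfold Phi shiftCoeff
  field_simp
  linear_combination -h

lemma Phi_shift_sub_right {x a b k : ℂ} (hx : x ∉ L.lattice) (hxa : x + a ∉ L.lattice)
    (hxb : x + b ∉ L.lattice) (ha : a ∉ L.lattice) (hb : b ∉ L.lattice)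
    (hk : k ∉ L.lattice) :
    Phi L b (-k) * Phi L (x + b) k - Phi L a (-k) * Phi L (x + a) k =
      shiftCoeff L x a b * Phi L x k := by
  have h := sigma_fay L (x + k) a b (-k)
  have h1 := sigma_ne_zero L hx
  have h2 := sigma_ne_zero L hxa
  have h3 := sigma_ne_zero L hxb
  have h5 := sigma_ne_zero L ha
  have h6 := sigma_ne_zero L hb
  have h7 := sigma_ne_zero L hk
  have e1 : x + k + a + b + -k = x + a + b := by ring
  have e2 : x + k + b + -k = x + b := by ring
  have e3 : x + k + a + -k = x + a := by ring
  have e4 : x + k + a = x + a + k := by ring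
  have e5 : x + k + b = x + b + k := by ring
  rw [e1, e2, e3, e4, e5, ← sub_eq_add_neg a, ← sub_eq_add_neg b, sigma_neg] at h
  unfold Phi shiftCoeff
  rw [← sub_eq_add_neg b, ← sub_eq_add_neg a, sigma_neg]
  field_simp
  linear_combination h

/-- Additivity supplies the hypothesis k₁ + k₂ = k₃ of `det_bilinear`. -/
lemma shiftCoeff_add {x a b c : ℂ} (hxa : x + a ∉ L.lattice) (hxb : x + b ∉ L.lattice)
    (hxc : x + c ∉ L.lattice) (ha : a ∉ L.lattice) (hb : b ∉ L.lattice) (hc : c ∉ L.lattice) :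
    shiftCoeff L x a b + shiftCoeff L x b c = shiftCoeff L x a c := by
  have h := sigma_fay L (x + c) a b (-c)
  have h2 := sigma_ne_zero L hxa
  have h3 := sigma_ne_zero L hxb
  have h4 := sigma_ne_zero L hxc
  have h5 := sigma_ne_zero L ha
  have h6 := sigma_ne_zero L hb
  have h7 := sigma_ne_zero L hc
  have e1 : x + c + a + b + -c = x + a + b := by ring
  have e2 : x + c + b + -c = x + b := by ring
  have e3 : x + c + a + -c = x + a := by ring
  have e4 : x + c + a = x + a + c := by ring
  have e5 : x + c + b = x + b + c := by ring
  rw [e1, e2, e3, e4, e5, ← sub_eq_add_neg a, ← sub_eq_add_neg b, sigma_neg] at h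
  unfold shiftCoeff
  field_simp
  linear_combination -sigma L x * h

end EllipticTau

end

/-! ### Nondegeneracy and shifts of the plane wave factors -/

section

open Filter Topology Complex

namespace EllipticTau

/-- The nondegeneracy conditions on the lattice parameters and the spectral parameters. -/
structure Admissible (L : PeriodPair) (a b c : ℂ) {N : ℕ} (κ : Fin N → ℂ) : Prop where
  a_notMem : a ∉ L.lattice
  b_notMem : b ∉ L.lattice
  c_notMem : c ∉ L.lattice
  add_notMem : ∀ i j, κ i + κ j ∉ L.lattice
  κ_a : ∀ i, κ i + a ∉ L.lattice ∧ κ i - a ∉ L.lattice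
  κ_b : ∀ i, κ i + b ∉ L.lattice ∧ κ i - b ∉ L.lattice
  κ_c : ∀ i, κ i + c ∉ L.lattice ∧ κ i - c ∉ L.lattice

variable {L : PeriodPair} {a b c ξ₀ : ℂ} {N : ℕ} {κ ρ₀ : Fin N → ℂ}

lemma Admissible.κ_notMem (h : Admissible L a b c κ) (i : Fin N) : κ i ∉ L.lattice :=
  fun hi => h.add_notMem i i (add_mem hi hi)

lemma Admissible.neg_c (h : Admissible L a b c κ) : Admissible L a b (-c) κ where
  a_notMem := h.a_notMem
  b_notMem := h.b_notMem
  c_notMem := fun hc => h.c_notMem (by simpa using neg_mem hc)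
  add_notMem := h.add_notMem
  κ_a := h.κ_a
  κ_b := h.κ_b
  κ_c := fun i => ⟨by simpa [sub_eq_add_neg] using (h.κ_c i).2, by simpa using (h.κ_c i).1⟩

lemma Phi_ne_zero_of_admissible {d k : ℂ} (hd : d ∉ L.lattice) (hk : k ∉ L.lattice)
    (h : k + d ∉ L.lattice ∧ k - d ∉ L.lattice) : Phi L d k ≠ 0 ∧ Phi L d (-k) ≠ 0 := by
  refine ⟨Phi_ne_zero hd hk (by rw [add_comm]; exact h.1),
    Phi_ne_zero hd (fun h' => hk (by simpa using neg_mem h')) fun h' => h.2 ?_⟩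
  have := neg_mem h'
  rwa [neg_add, neg_neg, add_comm, ← sub_eq_add_neg] at this

/-- The column vector `S_i Φ_ξ(κ_i)`. -/
noncomputable def colVec (L : PeriodPair) (a b c ξ₀ : ℂ) {N : ℕ} (κ ρ₀ : Fin N → ℂ) (n m l : ℤ)
    (i : Fin N) : ℂ :=
  S L a b c κ ρ₀ n m l i * Phi L (xi a b c ξ₀ n m l) (κ i)

/-- The row vector `Φ_ξ(κ_j) T_j`. -/
noncomputable def rowVec (L : PeriodPair) (a b c ξ₀ : ℂ) {N : ℕ} (κ ρ₀ : Fin N → ℂ) (n m l : ℤ)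
    (j : Fin N) : ℂ :=
  Phi L (xi a b c ξ₀ n m l) (κ j) * T L a b c κ ρ₀ n m l j

lemma xi_a (n m l : ℤ) : xi a b c ξ₀ (n + 1) m l = xi a b c ξ₀ n m l + a := by
  unfold xi; push_cast; ring

lemma xi_b (n m l : ℤ) : xi a b c ξ₀ n (m + 1) l = xi a b c ξ₀ n m l + b := by
  unfold xi; push_cast; ring

lemma xi_c (n m l : ℤ) : xi a b c ξ₀ n m (l + 1) = xi a b c ξ₀ n m l + c := by
  unfold xi; push_cast; ring

lemma S_a (h : Admissible L a b c κ) (n m l : ℤ) (i : Fin N) :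
    S L a b c κ ρ₀ (n + 1) m l i = Phi L a (-κ i) * S L a b c κ ρ₀ n m l i := by
  have := Phi_ne_zero_of_admissible h.a_notMem (h.κ_notMem i) (h.κ_a i)
  unfold S; rw [zpow_add_one₀ this.2]; ring

lemma S_b (h : Admissible L a b c κ) (n m l : ℤ) (i : Fin N) :
    S L a b c κ ρ₀ n (m + 1) l i = Phi L b (-κ i) * S L a b c κ ρ₀ n m l i := by
  have := Phi_ne_zero_of_admissible h.b_notMem (h.κ_notMem i) (h.κ_b i)
  unfold S; rw [zpow_add_one₀ this.2]; ring

lemma S_c (h : Admissible L a b c κ) (n m l : ℤ) (i : Fin N) :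
    S L a b c κ ρ₀ n m (l + 1) i = Phi L c (-κ i) * S L a b c κ ρ₀ n m l i := by
  have := Phi_ne_zero_of_admissible h.c_notMem (h.κ_notMem i) (h.κ_c i)
  unfold S; rw [zpow_add_one₀ this.2]; ring

lemma T_a (h : Admissible L a b c κ) (n m l : ℤ) (i : Fin N) :
    T L a b c κ ρ₀ n m l i = Phi L a (κ i) * T L a b c κ ρ₀ (n + 1) m l i := by
  have := Phi_ne_zero_of_admissible h.a_notMem (h.κ_notMem i) (h.κ_a i)
  unfold T; rw [zpow_neg _ (n + 1), zpow_neg _ n, zpow_add_one₀ this.1]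
  field_simp [this.1]

lemma T_b (h : Admissible L a b c κ) (n m l : ℤ) (i : Fin N) :
    T L a b c κ ρ₀ n m l i = Phi L b (κ i) * T L a b c κ ρ₀ n (m + 1) l i := by
  have := Phi_ne_zero_of_admissible h.b_notMem (h.κ_notMem i) (h.κ_b i)
  unfold T; rw [zpow_neg _ (m + 1), zpow_neg _ m, zpow_add_one₀ this.1]
  field_simp [this.1]

lemma T_c (h : Admissible L a b c κ) (n m l : ℤ) (i : Fin N) :
    T L a b c κ ρ₀ n m l i = Phi L c (κ i) * T L a b c κ ρ₀ n m (l + 1) i := by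
  have := Phi_ne_zero_of_admissible h.c_notMem (h.κ_notMem i) (h.κ_c i)
  unfold T; rw [zpow_neg _ (l + 1), zpow_neg _ l, zpow_add_one₀ this.1]
  field_simp [this.1]

end EllipticTau

end

/-! ### Rank-one updates of the Cauchy matrix and dAKP -/

section

open Filter Topology Complex Matrix

namespace EllipticTau

variable {L : PeriodPair} {a b c ξ₀ : ℂ} {N : ℕ} {κ ρ₀ : Fin N → ℂ}

/-- Common core of the three shift directions: d is the lattice parameter, s and t the plane wave
factors, primes the shifted values. -/
lemma shift_entry {x d p q s s' t t' : ℂ} (hs : s' = Phi L d (-p) * s) (ht : t = Phi L d q * t')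
    (hx : x ∉ L.lattice) (hxd : x + d ∉ L.lattice) (hd : d ∉ L.lattice) (hp : p ∉ L.lattice)
    (hq : q ∉ L.lattice) (hpq : p + q ∉ L.lattice) :
    s' * Phi L (x + d) (p + q) * t' =
      s * Phi L x (p + q) * t - s * Phi L x p * (Phi L (x + d) q * t') := by
  rw [hs, ht]
  linear_combination s * t' * Phi_mul_Phi_shift hx hxd hd hp hq hpq

lemma cauchyM_a (h : Admissible L a b c κ) (n m l : ℤ) (h0 : DefinedAt L a b c ξ₀ n m l)
    (h1 : DefinedAt L a b c ξ₀ (n + 1) m l) :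
    cauchyM L a b c ξ₀ κ ρ₀ (n + 1) m l = cauchyM L a b c ξ₀ κ ρ₀ n m l -
      vecMulVec (colVec L a b c ξ₀ κ ρ₀ n m l) (rowVec L a b c ξ₀ κ ρ₀ (n + 1) m l) := by
  unfold DefinedAt at h1
  ext i j
  simp only [cauchyM, of_apply, Matrix.sub_apply, vecMulVec_apply, colVec, rowVec, xi_a] at h1 ⊢
  exact shift_entry (S_a h n m l i) (T_a h n m l j) h0 h1 h.a_notMem (h.κ_notMem i) (h.κ_notMem j)
    (h.add_notMem i j)

lemma cauchyM_b (h : Admissible L a b c κ) (n m l : ℤ) (h0 : DefinedAt L a b c ξ₀ n m l)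
    (h1 : DefinedAt L a b c ξ₀ n (m + 1) l) :
    cauchyM L a b c ξ₀ κ ρ₀ n (m + 1) l = cauchyM L a b c ξ₀ κ ρ₀ n m l -
      vecMulVec (colVec L a b c ξ₀ κ ρ₀ n m l) (rowVec L a b c ξ₀ κ ρ₀ n (m + 1) l) := by
  unfold DefinedAt at h1
  ext i j
  simp only [cauchyM, of_apply, Matrix.sub_apply, vecMulVec_apply, colVec, rowVec, xi_b] at h1 ⊢
  exact shift_entry (S_b h n m l i) (T_b h n m l j) h0 h1 h.b_notMem (h.κ_notMem i) (h.κ_notMem j)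
    (h.add_notMem i j)

lemma cauchyM_c (h : Admissible L a b c κ) (n m l : ℤ) (h0 : DefinedAt L a b c ξ₀ n m l)
    (h1 : DefinedAt L a b c ξ₀ n m (l + 1)) :
    cauchyM L a b c ξ₀ κ ρ₀ n m (l + 1) = cauchyM L a b c ξ₀ κ ρ₀ n m l -
      vecMulVec (colVec L a b c ξ₀ κ ρ₀ n m l) (rowVec L a b c ξ₀ κ ρ₀ n m (l + 1)) := by
  unfold DefinedAt at h1
  ext i j
  simp only [cauchyM, of_apply, Matrix.sub_apply, vecMulVec_apply, colVec, rowVec, xi_c] at h1 ⊢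
  exact shift_entry (S_c h n m l i) (T_c h n m l j) h0 h1 h.c_notMem (h.κ_notMem i) (h.κ_notMem j)
    (h.add_notMem i j)

lemma row_entry {x a b k t ta tb : ℂ} (hta : ta = Phi L b k * t) (htb : tb = Phi L a k * t)
    (hxa : x + a ∉ L.lattice) (hxb : x + b ∉ L.lattice) (hxab : x + a + b ∉ L.lattice)
    (ha : a ∉ L.lattice) (hb : b ∉ L.lattice) (hk : k ∉ L.lattice) :
    Phi L (x + a) k * ta - Phi L (x + b) k * tb =
      shiftCoeff L x a b * (Phi L (x + a + b) k * t) := by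
  rw [hta, htb]
  linear_combination t * Phi_shift_sub_left hxa hxb hxab ha hb hk

/-- The discrete AKP equation at a site where `τ` is defined. -/
lemma dAKP_tau_of_definedAt (h : Admissible L a b c κ) (n m l : ℤ)
    (h₀₀₀ : DefinedAt L a b c ξ₀ n m l)
    (h₁₁₀ : DefinedAt L a b c ξ₀ (n + 1) (m + 1) l)
    (h₀₀₁ : DefinedAt L a b c ξ₀ n m (l + 1))
    (h₀₁₁ : DefinedAt L a b c ξ₀ n (m + 1) (l + 1))
    (h₁₀₀ : DefinedAt L a b c ξ₀ (n + 1) m l)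
    (h₁₀₁ : DefinedAt L a b c ξ₀ (n + 1) m (l + 1))
    (h₀₁₀ : DefinedAt L a b c ξ₀ n (m + 1) l) :
    dAKP L a b c (tau L a b c ξ₀ κ ρ₀) n m l = 0 := by
  obtain ⟨x, hx⟩ : ∃ x, x = xi a b c ξ₀ n m l := ⟨_, rfl⟩
  have xa : xi a b c ξ₀ (n + 1) m l = x + a := by rw [hx, xi_a]
  have xb : xi a b c ξ₀ n (m + 1) l = x + b := by rw [hx, xi_b]
  have xc : xi a b c ξ₀ n m (l + 1) = x + c := by rw [hx, xi_c]
  have xab : xi a b c ξ₀ (n + 1) (m + 1) l = x + a + b := by rw [hx, xi_b, xi_a]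
  have xbc : xi a b c ξ₀ n (m + 1) (l + 1) = x + b + c := by rw [hx, xi_c, xi_b]
  have xac : xi a b c ξ₀ (n + 1) m (l + 1) = x + a + c := by rw [hx, xi_c, xi_a]
  have g₀₀₀ : x ∉ L.lattice := hx ▸ h₀₀₀
  have g₁₀₀ : x + a ∉ L.lattice := xa ▸ h₁₀₀
  have g₀₁₀ : x + b ∉ L.lattice := xb ▸ h₀₁₀
  have g₀₀₁ : x + c ∉ L.lattice := xc ▸ h₀₀₁
  have hab : rowVec L a b c ξ₀ κ ρ₀ (n + 1) m l - rowVec L a b c ξ₀ κ ρ₀ n (m + 1) l =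
      shiftCoeff L x a b • rowVec L a b c ξ₀ κ ρ₀ (n + 1) (m + 1) l := by
    ext i
    simp only [Pi.sub_apply, Pi.smul_apply, smul_eq_mul, rowVec, xa, xb, xab]
    exact row_entry (T_b h _ _ _ i) (T_a h _ _ _ i) g₁₀₀ g₀₁₀ (xab ▸ h₁₁₀)
      h.a_notMem h.b_notMem (h.κ_notMem i)
  have hbc : rowVec L a b c ξ₀ κ ρ₀ n (m + 1) l - rowVec L a b c ξ₀ κ ρ₀ n m (l + 1) =
      shiftCoeff L x b c • rowVec L a b c ξ₀ κ ρ₀ n (m + 1) (l + 1) := by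
    ext i
    simp only [Pi.sub_apply, Pi.smul_apply, smul_eq_mul, rowVec, xb, xc, xbc]
    exact row_entry (T_c h _ _ _ i) (T_b h _ _ _ i) g₀₁₀ g₀₀₁ (xbc ▸ h₀₁₁)
      h.b_notMem h.c_notMem (h.κ_notMem i)
  have hac : rowVec L a b c ξ₀ κ ρ₀ (n + 1) m l - rowVec L a b c ξ₀ κ ρ₀ n m (l + 1) =
      shiftCoeff L x a c • rowVec L a b c ξ₀ κ ρ₀ (n + 1) m (l + 1) := by
    ext i
    simp only [Pi.sub_apply, Pi.smul_apply, smul_eq_mul, rowVec, xa, xc, xac]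
    exact row_entry (T_c h _ _ _ i) (T_a h _ _ _ i) g₁₀₀ g₀₀₁ (xac ▸ h₁₀₁)
      h.a_notMem h.c_notMem (h.κ_notMem i)
  -- The bc-site is reached through the b-shifted site, the others through the a-shifted one; this
  -- relation expresses its column in the same two vectors.
  have hcol : colVec L a b c ξ₀ κ ρ₀ n (m + 1) l = colVec L a b c ξ₀ κ ρ₀ (n + 1) m l +
      shiftCoeff L x a b • colVec L a b c ξ₀ κ ρ₀ n m l := by
    ext i
    simp only [Pi.add_apply, Pi.smul_apply, smul_eq_mul, colVec, xa, xb, ← hx, S_a h, S_b h]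
    have := Phi_shift_sub_right g₀₀₀ g₁₀₀ g₀₁₀ h.a_notMem h.b_notMem
      (h.κ_notMem i)
    linear_combination S L a b c κ ρ₀ n m l i * this
  have key := det_bilinear (1 + cauchyM L a b c ξ₀ κ ρ₀ n m l) hcol hab hbc hac
    (shiftCoeff_add g₁₀₀ g₀₁₀ g₀₀₁ h.a_notMem h.b_notMem h.c_notMem)
  have e : ∀ {A B C : Matrix (Fin N) (Fin N) ℂ}, A = B - C → 1 + B - C = 1 + A := by
    intro A B C hABC
    rw [hABC, add_sub_assoc]
  rw [e (cauchyM_a h n m l h₀₀₀ h₁₀₀), e (cauchyM_b h n m l h₀₀₀ h₀₁₀),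
    e (cauchyM_c h n m l h₀₀₀ h₀₀₁), e (cauchyM_b h (n + 1) m l h₁₀₀ h₁₁₀),
    e (cauchyM_c h n (m + 1) l h₀₁₀ h₀₁₁), e (cauchyM_c h (n + 1) m l h₁₀₀ h₁₀₁)] at key
  have s0 := sigma_ne_zero L g₀₀₀
  have sa := sigma_ne_zero L g₁₀₀
  have sb := sigma_ne_zero L g₀₁₀
  have sc := sigma_ne_zero L g₀₀₁
  have ta := sigma_ne_zero L h.a_notMem
  have tb := sigma_ne_zero L h.b_notMem
  have tc := sigma_ne_zero L h.c_notMem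
  unfold dAKP tau
  rw [xa, xb, xc, xab, xbc, xac]
  generalize (1 + cauchyM L a b c ξ₀ κ ρ₀ (n + 1) m l).det = Fa at *
  generalize (1 + cauchyM L a b c ξ₀ κ ρ₀ n (m + 1) l).det = Fb at *
  generalize (1 + cauchyM L a b c ξ₀ κ ρ₀ n m (l + 1)).det = Fc at *
  generalize (1 + cauchyM L a b c ξ₀ κ ρ₀ (n + 1) (m + 1) l).det = Fab at *
  generalize (1 + cauchyM L a b c ξ₀ κ ρ₀ n (m + 1) (l + 1)).det = Fbc at *
  generalize (1 + cauchyM L a b c ξ₀ κ ρ₀ (n + 1) m (l + 1)).det = Fac at *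
  have hca : c - a = -(a - c) := by ring
  unfold shiftCoeff at key
  unfold Phi
  rw [← sub_eq_add_neg, ← sub_eq_add_neg, ← sub_eq_add_neg, hca, sigma_neg, sigma_neg, sigma_neg,
    sigma_neg]
  field_simp at key ⊢
  -- Every `shiftCoeff` carries a factor σ(x) that is absent from dAKP, so it is restored before
  -- comparison.
  refine mul_left_cancel₀ s0 ?_
  linear_combination -key

end EllipticTau

end

/-! ### Removing the base-site condition, reversing c, and dBKP -/

section

open Filter Topology Complex Matrix

namespace EllipticTau

variable {L : PeriodPair} {a b c ξ₀ : ℂ} {N : ℕ} {κ ρ₀ : Fin N → ℂ}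

lemma continuous_xi (n m l : ℤ) : Continuous fun ξ => xi a b c ξ n m l := by
  unfold xi; fun_prop

lemma eventually_definedAt {n m l : ℤ} (h : DefinedAt L a b c ξ₀ n m l) :
    ∀ᶠ ξ in 𝓝 ξ₀, DefinedAt L a b c ξ n m l :=
  (continuous_xi n m l).continuousAt.eventually ((isOpen_compl_lattice L).mem_nhds h)

lemma frequently_definedAt (n m l : ℤ) : ∃ᶠ ξ in 𝓝 ξ₀, DefinedAt L a b c ξ n m l := by
  have hd : Dense {ξ | DefinedAt L a b c ξ n m l} := by
    have hc : (L.lattice : Set ℂ).Countable :=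
      Set.countable_coe_iff.mp (inferInstanceAs (Countable L.lattice))
    refine (Set.Countable.dense_compl ℂ
      (hc.preimage (f := fun ξ => xi a b c ξ n m l) fun ξ ξ' h => ?_)).mono fun ξ hξ => hξ
    simpa [xi] using h
  exact mem_closure_iff_frequently.mp (hd ξ₀)

lemma continuousAt_tau (h : Admissible L a b c κ) {n m l : ℤ} (hd : DefinedAt L a b c ξ₀ n m l) :
    ContinuousAt (fun ξ => tau L a b c ξ κ ρ₀ n m l) ξ₀ := by
  have hs : ∀ y : ℂ, ContinuousAt (fun ξ => sigma L (xi a b c ξ n m l + y)) ξ₀ := fun y =>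
    ((continuous_sigma L).comp ((continuous_xi n m l).add continuous_const)).continuousAt
  have hs0 : ContinuousAt (fun ξ => sigma L (xi a b c ξ n m l)) ξ₀ := by simpa using hs 0
  refine hs0.mul (ContinuousAt.comp (g := fun A : Matrix (Fin N) (Fin N) ℂ => A.det)
    (continuous_id.matrix_det).continuousAt (continuousAt_const.add ?_))
  refine continuousAt_pi.mpr fun i => continuousAt_pi.mpr fun j => ?_
  refine (continuousAt_const.mul ?_).mul continuousAt_const
  exact (hs _).div (hs0.mul continuousAt_const)
    (mul_ne_zero (sigma_ne_zero L hd) (sigma_ne_zero L (h.add_notMem i j)))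

/-- The discrete AKP equation for the elliptic soliton `τ` function. -/
lemma dAKP_tau (h : Admissible L a b c κ) (n m l : ℤ)
    (h₁₁₀ : DefinedAt L a b c ξ₀ (n + 1) (m + 1) l)
    (h₀₀₁ : DefinedAt L a b c ξ₀ n m (l + 1))
    (h₀₁₁ : DefinedAt L a b c ξ₀ n (m + 1) (l + 1))
    (h₁₀₀ : DefinedAt L a b c ξ₀ (n + 1) m l)
    (h₁₀₁ : DefinedAt L a b c ξ₀ (n + 1) m (l + 1))
    (h₀₁₀ : DefinedAt L a b c ξ₀ n (m + 1) l) :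
    dAKP L a b c (tau L a b c ξ₀ κ ρ₀) n m l = 0 := by
  have hcont : ContinuousAt (fun ξ => dAKP L a b c (tau L a b c ξ κ ρ₀) n m l) ξ₀ := by
    unfold dAKP
    exact ((((continuousAt_const.mul (continuousAt_tau h h₁₁₀)).mul (continuousAt_tau h h₀₀₁)).add
      ((continuousAt_const.mul (continuousAt_tau h h₀₁₁)).mul (continuousAt_tau h h₁₀₀))).add
      ((continuousAt_const.mul (continuousAt_tau h h₁₀₁)).mul (continuousAt_tau h h₀₁₀)))
  -- A nonzero value would persist for ξ near ξ₀, including some ξ at which the base site is defined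
  -- and the equation is already proved.
  by_contra hne
  refine frequently_definedAt (L := L) (a := a) (b := b) (c := c) (ξ₀ := ξ₀) n m l ?_
  filter_upwards [hcont.eventually_ne hne, eventually_definedAt h₁₁₀, eventually_definedAt h₀₀₁,
    eventually_definedAt h₀₁₁, eventually_definedAt h₁₀₀, eventually_definedAt h₁₀₁,
    eventually_definedAt h₀₁₀] with ξ hξ h1 h2 h3 h4 h5 h6 h0
  exact hξ (dAKP_tau_of_definedAt h n m l h0 h1 h2 h3 h4 h5 h6)

lemma xi_neg_c (n m l : ℤ) : xi a b (-c) ξ₀ n m (-l) = xi a b c ξ₀ n m l := by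
  unfold xi; push_cast; ring

lemma S_neg_c (h : Admissible L a b c κ) (n m l : ℤ) (i : Fin N) :
    S L a b (-c) κ ρ₀ n m (-l) i =
      (-(Phi L c (κ i) * Phi L c (-κ i))) ^ (-l) * S L a b c κ ρ₀ n m l i := by
  have hc := Phi_ne_zero_of_admissible h.c_notMem (h.κ_notMem i) (h.κ_c i)
  unfold S
  rw [Phi_neg_neg, ← neg_mul, mul_zpow, zpow_neg (Phi L c (-κ i))]
  field_simp [zpow_ne_zero l hc.2]

lemma T_neg_c (h : Admissible L a b c κ) (n m l : ℤ) (i : Fin N) :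
    T L a b (-c) κ ρ₀ n m (-l) i =
      T L a b c κ ρ₀ n m l i * ((-(Phi L c (κ i) * Phi L c (-κ i))) ^ (-l))⁻¹ := by
  have hc := Phi_ne_zero_of_admissible h.c_notMem (h.κ_notMem i) (h.κ_c i)
  unfold T
  rw [Phi_neg_left, ← mul_neg, mul_zpow, zpow_neg (-Phi L c (-κ i)) (-l)]
  have h1 := zpow_ne_zero (-l) hc.1
  have h2 := zpow_ne_zero (-l) (neg_ne_zero.mpr hc.2)
  field_simp

/-- Reversing the direction `c` together with the sign of `l` does not change `τ`. -/
lemma tau_neg_c (h : Admissible L a b c κ) (n m l : ℤ) :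
    tau L a b (-c) ξ₀ κ ρ₀ n m (-l) = tau L a b c ξ₀ κ ρ₀ n m l := by
  set d : Fin N → ℂ := fun i => (-(Phi L c (κ i) * Phi L c (-κ i))) ^ (-l) with hd
  have hne : ∀ i, d i ≠ 0 := fun i => by
    have hc := Phi_ne_zero_of_admissible h.c_notMem (h.κ_notMem i) (h.κ_c i)
    exact zpow_ne_zero _ (neg_ne_zero.mpr (mul_ne_zero hc.1 hc.2))
  have hinv : diagonal d * diagonal (fun i => (d i)⁻¹) = 1 := by
    rw [diagonal_mul_diagonal, ← diagonal_one]
    congr 1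
    ext i
    exact mul_inv_cancel₀ (hne i)
  have hM : 1 + cauchyM L a b (-c) ξ₀ κ ρ₀ n m (-l) =
      diagonal d * (1 + cauchyM L a b c ξ₀ κ ρ₀ n m l) * diagonal (fun i => (d i)⁻¹) := by
    rw [mul_add, add_mul, mul_one, hinv]
    congr 1
    ext i j
    rw [mul_diagonal, diagonal_mul]
    simp only [cauchyM, of_apply, xi_neg_c, S_neg_c h, T_neg_c h, hd]
    ring
  unfold tau
  rw [hM, xi_neg_c, det_mul, det_mul, mul_right_comm, ← det_mul, hinv, det_one, one_mul]

/-- The discrete AKP equation with the direction `c` reversed. -/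
lemma dAKP_tau_neg_c (h : Admissible L a b c κ) (n m l : ℤ)
    (h₀₀₀ : DefinedAt L a b c ξ₀ n m l)
    (h₁₁₁ : DefinedAt L a b c ξ₀ (n + 1) (m + 1) (l + 1))
    (h₀₁₁ : DefinedAt L a b c ξ₀ n (m + 1) (l + 1))
    (h₁₀₀ : DefinedAt L a b c ξ₀ (n + 1) m l)
    (h₁₀₁ : DefinedAt L a b c ξ₀ (n + 1) m (l + 1))
    (h₀₁₀ : DefinedAt L a b c ξ₀ n (m + 1) l) :
    Phi L a (-b) * tau L a b c ξ₀ κ ρ₀ (n + 1) (m + 1) (l + 1) * tau L a b c ξ₀ κ ρ₀ n m l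
      + Phi L b c * tau L a b c ξ₀ κ ρ₀ n (m + 1) l * tau L a b c ξ₀ κ ρ₀ (n + 1) m (l + 1)
      - Phi L a c * tau L a b c ξ₀ κ ρ₀ (n + 1) m l * tau L a b c ξ₀ κ ρ₀ n (m + 1) (l + 1) = 0 := by
  have hl : -(l + 1) + 1 = -l := by ring
  have hD : ∀ {n m l : ℤ}, DefinedAt L a b c ξ₀ n m l → DefinedAt L a b (-c) ξ₀ n m (-l) := by
    intro n m l hdef
    unfold DefinedAt
    rwa [xi_neg_c]
  -- The reversed lattice is based at -(l + 1), so that its forward step lands on -l and the two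
  -- levels correspond to l + 1 and l.
  have key := dAKP_tau (ρ₀ := ρ₀) h.neg_c n m (-(l + 1)) (hD h₁₁₁) (hl ▸ hD h₀₀₀) (hl ▸ hD h₀₁₀)
    (hD h₁₀₁) (hl ▸ hD h₁₀₀) (hD h₀₁₁)
  unfold dAKP at key
  rw [hl] at key
  simp only [tau_neg_c h, neg_neg, Phi_neg_neg, Phi_comm c a] at key
  linear_combination key

/-- The discrete BKP equation for the elliptic soliton `τ` function. -/
lemma dBKP_tau (h : Admissible L a b c κ) (n m l : ℤ)
    (h₁₁₀ : DefinedAt L a b c ξ₀ (n + 1) (m + 1) l)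
    (h₀₀₁ : DefinedAt L a b c ξ₀ n m (l + 1))
    (h₀₁₁ : DefinedAt L a b c ξ₀ n (m + 1) (l + 1))
    (h₁₀₀ : DefinedAt L a b c ξ₀ (n + 1) m l)
    (h₁₀₁ : DefinedAt L a b c ξ₀ (n + 1) m (l + 1))
    (h₀₁₀ : DefinedAt L a b c ξ₀ n (m + 1) l)
    (h₀₀₀ : DefinedAt L a b c ξ₀ n m l)
    (h₁₁₁ : DefinedAt L a b c ξ₀ (n + 1) (m + 1) (l + 1)) :
    dBKP L a b c (tau L a b c ξ₀ κ ρ₀) n m l = 0 := by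
  have h1 := dAKP_tau (ρ₀ := ρ₀) h n m l h₁₁₀ h₀₀₁ h₀₁₁ h₁₀₀ h₁₀₁ h₀₁₀
  have h2 := dAKP_tau_neg_c (ρ₀ := ρ₀) h n m l h₀₀₀ h₁₁₁ h₀₁₁ h₁₀₀ h₁₀₁ h₀₁₀
  have h3 := Phi_mul_Phi_neg h.b_notMem h.c_notMem
  have h4 := Phi_mul_Phi_neg h.c_notMem h.a_notMem
  rw [Phi_comm c a] at h4
  unfold dAKP at h1
  unfold dBKP
  -- The first multiplier creates the required triple product of Φ. It also turns the other two
  -- reversed terms into differences of ℘-values, whose ℘(c) parts cancel against ℘(c) times dAKP.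
  linear_combination Phi L b (-c) * Phi L c (-a) * h2 + L.weierstrassP c * h1 -
    Phi L c (-a) * tau L a b c ξ₀ κ ρ₀ n (m + 1) l * tau L a b c ξ₀ κ ρ₀ (n + 1) m (l + 1) * h3 +
    Phi L b (-c) * tau L a b c ξ₀ κ ρ₀ (n + 1) m l * tau L a b c ξ₀ κ ρ₀ n (m + 1) (l + 1) * h4

end EllipticTau

end

theorem theorem7 (L : PeriodPair) (a b c ξ₀ : ℂ) (N : ℕ) (κ ρ₀ : Fin N → ℂ)
    (ha : a ∉ L.lattice) (hb : b ∉ L.lattice) (hc : c ∉ L.lattice)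
    (hκ : ∀ i j, κ i + κ j ∉ L.lattice)
    (hκa : ∀ i, κ i + a ∉ L.lattice ∧ κ i - a ∉ L.lattice)
    (hκb : ∀ i, κ i + b ∉ L.lattice ∧ κ i - b ∉ L.lattice)
    (hκc : ∀ i, κ i + c ∉ L.lattice ∧ κ i - c ∉ L.lattice)
    (n m l : ℤ)
    (h₁₁₀ : EllipticTau.DefinedAt L a b c ξ₀ (n + 1) (m + 1) l)
    (h₀₀₁ : EllipticTau.DefinedAt L a b c ξ₀ n m (l + 1))
    (h₀₁₁ : EllipticTau.DefinedAt L a b c ξ₀ n (m + 1) (l + 1))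
    (h₁₀₀ : EllipticTau.DefinedAt L a b c ξ₀ (n + 1) m l)
    (h₁₀₁ : EllipticTau.DefinedAt L a b c ξ₀ (n + 1) m (l + 1))
    (h₀₁₀ : EllipticTau.DefinedAt L a b c ξ₀ n (m + 1) l) :
    EllipticTau.dAKP L a b c (EllipticTau.tau L a b c ξ₀ κ ρ₀) n m l = 0 ∧
      (EllipticTau.DefinedAt L a b c ξ₀ n m l →
        EllipticTau.DefinedAt L a b c ξ₀ (n + 1) (m + 1) (l + 1) →
        EllipticTau.dBKP L a b c (EllipticTau.tau L a b c ξ₀ κ ρ₀) n m l = 0) :=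
  have h : EllipticTau.Admissible L a b c κ := ⟨ha, hb, hc, hκ, hκa, hκb, hκc⟩
  ⟨EllipticTau.dAKP_tau h n m l h₁₁₀ h₀₀₁ h₀₁₁ h₁₀₀ h₁₀₁ h₀₁₀, fun h₀₀₀ h₁₁₁ =>
    EllipticTau.dBKP_tau h n m l h₁₁₀ h₀₀₁ h₀₁₁ h₁₀₀ h₁₀₁ h₀₁₀ h₀₀₀ h₁₁₁⟩
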